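/- For integers $n\ge 1$ and $0\le m\le\binom n2$, let $G(n,m)$ be a uniformly random simple graph on the vertex set $\{1,\dots,n\}$ with exactly $m$ edges, and let $X_{n,m}$ be the number of spanning trees of $G(n,m)$. Let $0<\delta<1/2$ be a constant and let $t\ge 0$ be a fixed integer. Then there exists a constant $K$, depending only on $\delta$ and $t$, such that for all integers $n\ge 1$ and $0\le m\le\binom n2$ with $\delta n^2\le m\le(1-\delta)n^2$, $$\mathbb P\left[X_{n,m}>K\,\mathbb E X_{n,m}\right]\le n^{-t}.$$ -/

import Mathlib

open MeasureTheory ProbabilityTheory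

/-- The random graph `G(n,m)`: the uniform probability measure on the set of simple graphs with
vertex set `Fin n` that have exactly `m` edges. -/
noncomputable def gnm (n m : ℕ) : Measure (SimpleGraph (Fin n)) :=
  uniformOn {G : SimpleGraph (Fin n) | G.edgeSet.ncard = m}

/-- The number of spanning trees of the graph `G`, that is, the number of trees on the whole vertex
set all of whose edges are edges of `G`. -/
noncomputable def numSpanningTrees {n : ℕ} (G : SimpleGraph (Fin n)) : ℕ :=
  {T : SimpleGraph (Fin n) | T ≤ G ∧ T.IsTree}.ncard

/-! The bad event is in fact empty: every graph with m edges has at most a constant times the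
average number of spanning trees. Put k = n-1 and N = n(n-1)/2. By the matrix-tree theorem the
number of spanning trees is det L, with L the reduced Laplacian. With J the all-ones matrix,
det(1+J) = n and tr(L(1+J)) = 2m, so AM-GM on eigenvalues gives n·X ≤ (2m/k)^k, that is, X ≤
τ(m/N)^k with τ = n^(n-2) the number of labelled trees (`card_mul_ncard_isTree_le`,
`card_mul_ncard_isTree`).

Counting the m-edge graphs above each tree gives E X ≥ τ·C(m,k)/C(N,k)
(`le_integral_numSpanningTrees`). The quotient of the two bounds is at most exp(k(k-1)/(m+1-k)),
which is bounded because m ≥ δn². -/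

open Matrix in
/-- A symmetrized form of the Cauchy-Binet formula. -/
theorem Matrix.factorial_mul_det_mul {R ι κ : Type*} [CommRing R] [Fintype ι] [DecidableEq ι]
    [Fintype κ] (A : Matrix ι κ R) (B : Matrix κ ι R) :
    ((Fintype.card ι).factorial : R) * (A * B).det =
      ∑ f : ι → κ, (A.submatrix id f).det * (B.submatrix f id).det := by
  classical
  have key : (A * B).det = ∑ f : ι → κ, (A.submatrix id f).det * ∏ i, B (f i) i := by
    simp only [det_apply', mul_apply, Finset.prod_univ_sum, Finset.mul_sum,
      Fintype.piFinset_univ, Finset.sum_mul, submatrix_apply, id]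
    rw [Finset.sum_comm]
    refine Finset.sum_congr rfl fun f _ => Finset.sum_congr rfl fun σ _ => ?_
    rw [Finset.prod_mul_distrib, mul_assoc]
  -- Reindexing f by σ permutes the columns of the first minor, at the cost of a sign. Summing over
  -- all σ then assembles the second minor.
  have perm : ∀ σ : Equiv.Perm ι, (A * B).det =
      ∑ f : ι → κ, (A.submatrix id f).det *
        ((Equiv.Perm.sign σ : ℤ) * ∏ i, B (f (σ i)) i) := by
    intro σ
    rw [key, ← Equiv.sum_comp (Equiv.arrowCongr σ.symm (Equiv.refl κ))]
    refine Finset.sum_congr rfl fun f _ => ?_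
    have h : A.submatrix id (Equiv.arrowCongr σ.symm (Equiv.refl κ) f) =
        (A.submatrix id f).submatrix id σ := by
      ext i j
      simp
    rw [h, det_permute']
    simp
    ring
  rw [← Fintype.card_perm, ← nsmul_eq_mul, ← Finset.card_univ, ← Finset.sum_const,
    Finset.sum_congr rfl fun σ _ => perm σ, Finset.sum_comm]
  refine Finset.sum_congr rfl fun f _ => ?_
  rw [← Finset.mul_sum, det_apply' (B.submatrix f id)]
  simp only [submatrix_apply, id]

/-! ### The matrix-tree theorem -/

namespace SimpleGraph

variable {V : Type*}

/-- The signed incidence matrix of `G` for an arbitrary orientation of the edges, with the row of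
the vertex `r` removed. -/
noncomputable def redIncMatrix [DecidableEq V] (G : SimpleGraph V) (r : V) : Matrix {v : V // v ≠ r} G.edgeSet ℤ :=
  fun v e => (if v.1 = (Quot.out e.1).1 then 1 else 0) - (if v.1 = (Quot.out e.1).2 then 1 else 0)

theorem mk_out (e : Sym2 V) : s((Quot.out e).1, (Quot.out e).2) = e := Quot.out_eq e

theorem adj_out (G : SimpleGraph V) (e : G.edgeSet) :
    G.Adj (Quot.out e.1).1 (Quot.out e.1).2 := by
  rw [← mem_edgeSet, mk_out]
  exact e.2

/-- The spanning subgraph formed by a family of edges of `G`. -/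
def famGraph {ι : Type*} (G : SimpleGraph V) (f : ι → G.edgeSet) : SimpleGraph V :=
  fromEdgeSet (Set.range fun i => (f i : Sym2 V))

theorem edgeSet_famGraph {ι : Type*} (G : SimpleGraph V) (f : ι → G.edgeSet) :
    (G.famGraph f).edgeSet = Set.range fun i => (f i : Sym2 V) := by
  rw [famGraph, edgeSet_fromEdgeSet, sdiff_eq_left, Set.disjoint_left]
  rintro _ ⟨i, rfl⟩ h
  exact G.not_isDiag_of_mem_edgeSet (f i).2 h

/-- Signed edge columns telescope along a walk from r to w; the contribution of r vanishes because
its row is removed. -/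
theorem exists_redIncMatrix_mulVec [Fintype V] [DecidableEq V] (G : SimpleGraph V) (r : V) (f : {v : V // v ≠ r} → G.edgeSet)
    {w : V} (hw : (G.famGraph f).Reachable r w) :
    ∃ y : {v : V // v ≠ r} → ℤ, ((G.redIncMatrix r).submatrix id f).mulVec y =
      fun v => if v.1 = w then 1 else 0 := by
  rw [reachable_iff_reflTransGen] at hw
  induction hw with
  | refl =>
    refine ⟨0, ?_⟩
    ext v
    simp [v.2]
  | @tail b c _ h ih =>
    obtain ⟨y, hy⟩ := ih
    rw [← mem_edgeSet, edgeSet_famGraph] at h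
    obtain ⟨i, hi⟩ := h
    simp only at hi
    have h2 := mk_out (f i).1
    rw [hi, Sym2.eq_iff] at h2
    rcases h2 with ⟨h1, h2⟩ | ⟨h1, h2⟩
    · refine ⟨y - Pi.single i 1, ?_⟩
      rw [Matrix.mulVec_sub, hy, Matrix.mulVec_single_one]
      ext v
      simp only [Pi.sub_apply, Matrix.col_apply, Matrix.submatrix_apply, redIncMatrix, id, hi, h1, h2]
      ring
    · refine ⟨y + Pi.single i 1, ?_⟩
      rw [Matrix.mulVec_add, hy, Matrix.mulVec_single_one]
      ext v
      simp only [Pi.add_apply, Matrix.col_apply, Matrix.submatrix_apply, redIncMatrix, id, hi, h1, h2]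
      ring

/-- The telescoped combinations form an integral right inverse, so the determinant is a unit of ℤ.
-/
theorem det_redIncMatrix_mul_self_of_connected [Fintype V] [DecidableEq V] (G : SimpleGraph V) (r : V)
    (f : {v : V // v ≠ r} → G.edgeSet) (h : (G.famGraph f).Connected) :
    ((G.redIncMatrix r).submatrix id f).det * ((G.redIncMatrix r).submatrix id f).det = 1 := by
  choose y hy using fun w : {v : V // v ≠ r} => G.exists_redIncMatrix_mulVec r f (h.preconnected r w.1)
  have hu : (G.redIncMatrix r).submatrix id f * (Matrix.of y).transpose = 1 := by
    ext v w
    have := congrFun (hy w) v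
    rw [Matrix.mul_apply]
    rw [Matrix.mulVec, dotProduct] at this
    simp only [Matrix.transpose_apply, Matrix.of_apply]
    rw [this, Matrix.one_apply]
    simp [Subtype.ext_iff]
  exact Int.isUnit_mul_self (Matrix.isUnit_det_of_right_inverse hu)

/-- The indicator of the vertices not reachable from r is a nonzero left null vector: it is constant
along each chosen edge and vanishes at r. -/
theorem det_redIncMatrix_of_not_connected [Fintype V] [DecidableEq V] (G : SimpleGraph V) (r : V)
    (f : {v : V // v ≠ r} → G.edgeSet) (h : ¬ (G.famGraph f).Connected) :
    ((G.redIncMatrix r).submatrix id f).det = 0 := by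
  classical
  have : ∃ w, ¬ (G.famGraph f).Reachable r w := by
    by_contra! hc
    exact h ((connected_iff_exists_forall_reachable _).2 ⟨r, hc⟩)
  obtain ⟨w, hw⟩ := this
  rw [← Matrix.exists_vecMul_eq_zero_iff]
  set x : V → ℤ := fun v => if (G.famGraph f).Reachable r v then 0 else 1 with hx
  have hxr : x r = 0 := by simp [hx]
  refine ⟨fun v => x v.1, ?_, ?_⟩
  · intro h0
    have hwr : w ≠ r := by
      rintro rfl
      exact hw (Reachable.refl _)
    have := congrFun h0 ⟨w, hwr⟩
    simp [hx, hw] at this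
  · ext i
    have aux : ∀ u : V, ∑ v : {v : V // v ≠ r}, x v.1 * (if v.1 = u then 1 else 0) = x u := by
      intro u
      by_cases hu : u = r
      · subst hu
        rw [hxr]
        exact Finset.sum_eq_zero fun v _ => by simp [v.2]
      · rw [Finset.sum_eq_single ⟨u, hu⟩]
        · simp
        · intro b _ hb
          have : b.1 ≠ u := fun h => hb (Subtype.ext h)
          simp [this]
        · simp
    have hadj : (G.famGraph f).Adj (Quot.out (f i).1).1 (Quot.out (f i).1).2 := by
      rw [← mem_edgeSet, edgeSet_famGraph, mk_out]
      exact ⟨i, rfl⟩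
    simp only [Matrix.vecMul, dotProduct, Matrix.submatrix_apply, redIncMatrix, id, mul_sub,
      Finset.sum_sub_distrib, aux, Pi.zero_apply]
    have : (G.famGraph f).Reachable r (Quot.out (f i).1).1 ↔
        (G.famGraph f).Reachable r (Quot.out (f i).1).2 :=
      ⟨fun h => h.trans hadj.reachable, fun h => h.trans hadj.symm.reachable⟩
    simp [hx, this]

/-- The families are the bijections onto the edges of T; their number cancels the factorial in the
symmetrized Cauchy-Binet formula. -/
theorem card_famGraph_eq [Fintype V] [DecidableEq V] (G T : SimpleGraph V) (hT : T ≤ G) (hT' : T.IsTree) (r : V) :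
    Nat.card {f : {v : V // v ≠ r} → G.edgeSet // G.famGraph f = T} =
      (Fintype.card {v : V // v ≠ r}).factorial := by
  classical
  have hc : Fintype.card {v : V // v ≠ r} = Fintype.card T.edgeSet := by
    have h1 := (isTree_iff_connected_and_card.1 hT').2
    have h2 : Fintype.card {v : V // v ≠ r} = Fintype.card V - 1 := Set.card_ne_eq r
    rw [Nat.card_eq_fintype_card, Nat.card_eq_fintype_card] at h1
    omega
  let e := Fintype.equivOfCardEq hc
  rw [← Fintype.card_equiv e, ← Nat.card_eq_fintype_card]
  symm
  refine Nat.card_congr (Equiv.ofBijective (fun g : {v : V // v ≠ r} ≃ T.edgeSet =>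
    ⟨fun v => ⟨(g v).1, edgeSet_mono hT (g v).2⟩, ?_⟩) ⟨?_, ?_⟩)
  · rw [← edgeSet_inj, edgeSet_famGraph]
    ext x
    constructor
    · rintro ⟨i, rfl⟩
      exact (g i).2
    · intro hx
      exact ⟨g.symm ⟨x, hx⟩, by simp⟩
  · intro g g' h
    refine Equiv.ext fun v => Subtype.ext ?_
    have := congrFun (congrArg Subtype.val h) v
    simpa using this
  · rintro ⟨f, hf⟩
    rw [← edgeSet_inj, edgeSet_famGraph] at hf
    have hm : ∀ v, (f v).1 ∈ T.edgeSet := fun v => hf ▸ ⟨v, rfl⟩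
    have hs : Function.Surjective (fun v => (⟨(f v).1, hm v⟩ : T.edgeSet)) := by
      rintro ⟨x, hx⟩
      rw [← hf] at hx
      obtain ⟨v, hv⟩ := hx
      exact ⟨v, Subtype.ext hv⟩
    exact ⟨Equiv.ofBijective _ ((Fintype.bijective_iff_surjective_and_card _).2 ⟨hs, hc⟩), rfl⟩

theorem famGraph_le {ι : Type*} (G : SimpleGraph V) (f : ι → G.edgeSet) : G.famGraph f ≤ G := by
  rw [← edgeSet_subset_edgeSet, edgeSet_famGraph]
  rintro _ ⟨i, rfl⟩
  exact (f i).2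

theorem isTree_famGraph [Fintype V] [DecidableEq V] (G : SimpleGraph V) (r : V) (f : {v : V // v ≠ r} → G.edgeSet)
    (h : (G.famGraph f).Connected) : (G.famGraph f).IsTree := by
  classical
  rw [isTree_iff_connected_and_card]
  refine ⟨h, le_antisymm ?_ h.card_vert_le_card_edgeSet_add_one⟩
  have h1 : Nat.card (G.famGraph f).edgeSet ≤ Nat.card {v : V // v ≠ r} := by
    rw [edgeSet_famGraph]
    exact Finite.card_range_le _
  have h2 : Fintype.card {v : V // v ≠ r} = Fintype.card V - 1 := Set.card_ne_eq r
  have h3 : 0 < Fintype.card V := Fintype.card_pos_iff.2 ⟨r⟩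
  rw [Nat.card_eq_fintype_card (α := {v : V // v ≠ r})] at h1
  rw [Nat.card_eq_fintype_card (α := V)]
  omega

/-- The matrix-tree theorem. -/
theorem det_redIncMatrix_mul_transpose [Fintype V] [DecidableEq V] (G : SimpleGraph V)
    [Fintype G.edgeSet] (r : V) :
    (G.redIncMatrix r * (G.redIncMatrix r).transpose).det =
      ({T : SimpleGraph V | T ≤ G ∧ T.IsTree}.ncard : ℤ) := by
  classical
  have hk : ((Fintype.card {v : V // v ≠ r}).factorial : ℤ) ≠ 0 := by
    exact_mod_cast Nat.factorial_ne_zero _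
  apply mul_left_cancel₀ hk
  rw [Matrix.factorial_mul_det_mul]
  have h1 : ∀ f : {v : V // v ≠ r} → G.edgeSet,
      ((G.redIncMatrix r).submatrix id f).det * ((G.redIncMatrix r).transpose.submatrix f id).det =
        if (G.famGraph f).Connected then 1 else 0 := by
    intro f
    rw [← Matrix.transpose_submatrix, Matrix.det_transpose]
    split_ifs with h
    · exact G.det_redIncMatrix_mul_self_of_connected r f h
    · rw [G.det_redIncMatrix_of_not_connected r f h, mul_zero]
  rw [Finset.sum_congr rfl fun f _ => h1 f, Finset.sum_boole, Set.ncard_eq_toFinset_card',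
    Finset.card_eq_sum_card_fiberwise (f := fun f => G.famGraph f)
      (t := {T : SimpleGraph V | T ≤ G ∧ T.IsTree}.toFinset)]
  · rw [Finset.sum_congr rfl (g := fun _ => (Fintype.card {v : V // v ≠ r}).factorial)]
    · rw [Finset.sum_const, smul_eq_mul, mul_comm]
      push_cast
      rfl
    · intro T hT
      rw [Set.mem_toFinset] at hT
      rw [← G.card_famGraph_eq T hT.1 hT.2 r, Nat.card_eq_fintype_card, Fintype.card_subtype,
        Finset.filter_filter]
      congr 1
      ext f
      simp only [Finset.mem_filter, Finset.mem_univ, true_and]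
      exact ⟨fun h => h.2, fun h => ⟨h ▸ hT.2.connected, h⟩⟩
  · intro f hf
    simp only [Finset.coe_filter, Finset.mem_univ, true_and, Set.mem_ofPred_eq] at hf
    simp only [Set.coe_toFinset, Set.mem_ofPred_eq]
    exact ⟨G.famGraph_le f, G.isTree_famGraph r f hf⟩

end SimpleGraph

/-! ### Determinant inequalities -/

/-- The AM-GM inequality for the eigenvalues of a positive semidefinite matrix. -/
theorem Matrix.PosSemidef.det_le_trace_div_card_pow {ι : Type*} [Fintype ι] [DecidableEq ι]
    {P : Matrix ι ι ℝ} (hP : P.PosSemidef) :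
    P.det ≤ (P.trace / Fintype.card ι) ^ Fintype.card ι := by
  rcases isEmpty_or_nonempty ι with h | h
  · simp
  have hc : (0 : ℝ) < Fintype.card ι := by exact_mod_cast Fintype.card_pos
  have h0 := hP.eigenvalues_nonneg
  have h1 := Real.geom_mean_le_arith_mean Finset.univ (fun _ => (1 : ℝ)) hP.1.eigenvalues
    (fun _ _ => zero_le_one) (by simpa using hc) (fun i _ => h0 i)
  simp only [Real.rpow_one, one_mul, Finset.sum_const, Finset.card_univ, nsmul_eq_mul,
    mul_one] at h1
  rw [hP.1.det_eq_prod_eigenvalues, hP.1.trace_eq_sum_eigenvalues]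
  simp only [RCLike.ofReal_real_eq_id, id]
  have h2 : 0 ≤ ∏ i, hP.1.eigenvalues i := Finset.prod_nonneg fun i _ => h0 i
  calc _ = ((∏ i, hP.1.eigenvalues i) ^ ((Fintype.card ι : ℝ)⁻¹)) ^ Fintype.card ι := by
        rw [Real.rpow_inv_natCast_pow h2 Fintype.card_ne_zero]
    _ ≤ _ := pow_le_pow_left₀ (Real.rpow_nonneg h2 _) h1 _

open scoped MatrixOrder Matrix.Norms.L2Operator in
-- Writing Q = R*R, the matrix RPR* is positive semidefinite with the determinant and trace of PQ,
-- so AM-GM applies to it.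
theorem Matrix.PosSemidef.det_mul_det_le {ι : Type*} [Fintype ι] [DecidableEq ι]
    {P Q : Matrix ι ι ℝ} (hP : P.PosSemidef) (hQ : Q.PosSemidef) :
    P.det * Q.det ≤ ((P * Q).trace / Fintype.card ι) ^ Fintype.card ι := by
  obtain ⟨R, rfl⟩ := CStarAlgebra.nonneg_iff_eq_star_mul_self.mp hQ.nonneg
  have := (hP.mul_mul_conjTranspose_same R).det_le_trace_div_card_pow
  rw [Matrix.star_eq_conjTranspose]
  convert this using 1
  · simp only [Matrix.det_mul]
    ring
  · rw [← Matrix.mul_assoc, Matrix.trace_mul_comm, ← Matrix.mul_assoc]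

open Matrix in
theorem Matrix.det_one_add_of_one {ι R : Type*} [Fintype ι] [DecidableEq ι] [CommRing R] :
    (1 + Matrix.of fun _ _ : ι => (1 : R)).det = 1 + Fintype.card ι := by
  have := det_one_add_replicateCol_mul_replicateRow (ι := Unit) (fun _ : ι => (1 : R)) (fun _ => 1)
  convert this using 2
  · ext i j
    simp [Matrix.mul_apply]
  · simp [dotProduct]

/-! ### Upper bound on spanning trees, and Cayley's formula -/

namespace SimpleGraph

variable {V : Type*}

/-- This is the contribution of one edge to tr(L(1+J)): 2 + 0 if the edge avoids r, and 1 + 1 if it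
meets r. -/
theorem sum_redIncMatrix_sq [Fintype V] [DecidableEq V] (G : SimpleGraph V) (r : V)
    (e : G.edgeSet) :
    ∑ v, G.redIncMatrix r v e ^ 2 + (∑ v, G.redIncMatrix r v e) ^ 2 = 2 := by
  have hne := (G.adj_out e).ne
  set a := (Quot.out e.1).1
  set b := (Quot.out e.1).2
  have aux : ∀ u : V, ∑ v : {v : V // v ≠ r}, (if v.1 = u then (1 : ℤ) else 0) =
      if u = r then 0 else 1 := by
    intro u
    split_ifs with hu
    · subst hu
      exact Finset.sum_eq_zero fun v _ => by simp [v.2]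
    · rw [Finset.sum_eq_single ⟨u, hu⟩]
      · simp
      · intro b _ hb
        have : b.1 ≠ u := fun h => hb (Subtype.ext h)
        simp [this]
      · simp
  have hsq : ∀ v : {v : V // v ≠ r}, G.redIncMatrix r v e ^ 2 =
      (if v.1 = a then 1 else 0) + (if v.1 = b then 1 else 0) := by
    intro v
    change ((if v.1 = a then 1 else 0) - (if v.1 = b then 1 else 0)) ^ 2 = _
    split_ifs with h1 h2
    · exact absurd (h1.symm.trans h2) hne
    all_goals norm_num
  have hs : ∑ v, G.redIncMatrix r v e = (if a = r then 0 else 1) - (if b = r then 0 else 1) := by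
    rw [← aux a, ← aux b, ← Finset.sum_sub_distrib]
    rfl
  rw [hs, Finset.sum_congr rfl fun v _ => hsq v, Finset.sum_add_distrib, aux, aux]
  split_ifs with h1 h2
  · exact absurd (h1.trans h2.symm) hne
  all_goals norm_num

/-- The weight 1+J makes the trace independent of r and the bound sharp for the complete graph,
where L(1+J) is scalar. -/
theorem card_mul_ncard_isTree_le [Fintype V] (G : SimpleGraph V) [Nonempty V] :
    (Fintype.card V : ℝ) * ({T : SimpleGraph V | T ≤ G ∧ T.IsTree}.ncard : ℝ) ≤
      (2 * G.edgeSet.ncard / (Fintype.card V - 1 : ℕ)) ^ (Fintype.card V - 1) := by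
  classical
  obtain ⟨r⟩ := ‹Nonempty V›
  have hk : Fintype.card {v : V // v ≠ r} = Fintype.card V - 1 := Set.card_ne_eq r
  have hV : 0 < Fintype.card V := Fintype.card_pos_iff.2 ⟨r⟩
  set A : Matrix {v : V // v ≠ r} G.edgeSet ℝ := (G.redIncMatrix r).map (Int.castRingHom ℝ) with hA
  have hdet : (A * A.transpose).det = ({T : SimpleGraph V | T ≤ G ∧ T.IsTree}.ncard : ℝ) := by
    have h := congrArg (Int.castRingHom ℝ) (G.det_redIncMatrix_mul_transpose r)
    rw [RingHom.map_det, RingHom.mapMatrix_apply, Matrix.map_mul, Matrix.transpose_map] at h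
    simpa only [eq_intCast, Int.cast_natCast] using h
  have hP : (A * A.transpose).PosSemidef := by
    have := Matrix.posSemidef_self_mul_conjTranspose A
    rwa [Matrix.conjTranspose_eq_transpose_of_trivial] at this
  have hQ : (1 + Matrix.of fun _ _ : {v : V // v ≠ r} => (1 : ℝ)).PosSemidef := by
    refine Matrix.PosSemidef.one.add ?_
    convert Matrix.posSemidef_vecMulVec_self_star (fun _ : {v : V // v ≠ r} => (1 : ℝ)) using 1
    ext i j
    simp [Matrix.vecMulVec]
  have htr : ((A * A.transpose) * (1 + Matrix.of fun _ _ : {v : V // v ≠ r} => (1 : ℝ))).trace =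
      2 * (G.edgeSet.ncard : ℝ) := by
    have h1 : ∀ e : G.edgeSet, ∑ v, A v e ^ 2 + (∑ v, A v e) ^ 2 = 2 := by
      intro e
      have := G.sum_redIncMatrix_sq r e
      simp only [hA, Matrix.map_apply, Int.coe_castRingHom]
      exact_mod_cast this
    have h2 : ∑ e : G.edgeSet, (∑ v, A v e ^ 2 + (∑ v, A v e) ^ 2) = 2 * G.edgeSet.ncard := by
      rw [Finset.sum_congr rfl fun e _ => h1 e, Finset.sum_const, Finset.card_univ,
        ← Nat.card_eq_fintype_card, Nat.card_coe_set_eq, nsmul_eq_mul, mul_comm]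
    rw [← h2, mul_add, Matrix.trace_add, mul_one, Finset.sum_add_distrib]
    congr 1
    · simp only [Matrix.trace, Matrix.diag, Matrix.mul_apply, Matrix.transpose_apply, sq]
      rw [Finset.sum_comm]
    · simp only [Matrix.trace, Matrix.diag, Matrix.mul_apply, Matrix.transpose_apply, sq,
        Matrix.of_apply, mul_one, Finset.sum_mul_sum]
      rw [Finset.sum_congr rfl fun _ _ => Finset.sum_comm, Finset.sum_comm]
  have h := hP.det_mul_det_le hQ
  rw [hdet, htr, Matrix.det_one_add_of_one, hk] at h
  rw [mul_comm]
  convert h using 2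
  rw [Nat.cast_sub hV]
  simp

theorem redIncMatrix_mul_redIncMatrix [DecidableEq V] (G : SimpleGraph V) (r : V)
    (u v : {v : V // v ≠ r}) (e : G.edgeSet) :
    G.redIncMatrix r u e * G.redIncMatrix r v e =
      if u = v then (if u.1 ∈ e.1 then 1 else 0) else (if e.1 = s(u.1, v.1) then -1 else 0) := by
  have hne := (G.adj_out e).ne
  have he := mk_out e.1
  simp only [redIncMatrix, Subtype.ext_iff]
  generalize (Quot.out e.1).1 = a at *
  generalize (Quot.out e.1).2 = b at *
  have h1 : u.1 ∈ e.1 ↔ u.1 = a ∨ u.1 = b := by rw [← he, Sym2.mem_iff]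
  have h2 : e.1 = s(u.1, v.1) ↔ a = u.1 ∧ b = v.1 ∨ a = v.1 ∧ b = u.1 := by
    rw [← he, Sym2.eq_iff]
  rw [if_congr h1 rfl rfl, if_congr h2 rfl rfl]
  grind

theorem redIncMatrix_mul_transpose_top [Fintype V] [DecidableEq V] (r : V)
    [Fintype (⊤ : SimpleGraph V).edgeSet] :
    (⊤ : SimpleGraph V).redIncMatrix r * ((⊤ : SimpleGraph V).redIncMatrix r).transpose =
      (Fintype.card V : ℤ) • 1 - Matrix.of fun _ _ => 1 := by
  have hV : 0 < Fintype.card V := Fintype.card_pos_iff.2 ⟨r⟩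
  ext u v
  simp only [Matrix.mul_apply, Matrix.transpose_apply, redIncMatrix_mul_redIncMatrix,
    Matrix.sub_apply, Matrix.smul_apply, Matrix.one_apply, Matrix.of_apply]
  split_ifs with h
  · rw [← Finset.sum_subtype (f := fun e : Sym2 V => if u.1 ∈ e then (1 : ℤ) else 0)
      (⊤ : SimpleGraph V).edgeFinset (fun _ => mem_edgeFinset), Finset.sum_boole,
      ← incidenceFinset_eq_filter, card_incidenceFinset_eq_degree, complete_graph_degree,
      Nat.cast_sub hV]
    simp
  · rw [Finset.sum_eq_single ⟨s(u.1, v.1), by simpa [Subtype.ext_iff] using h⟩]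
    · simp
    · intro b _ hb
      rw [if_neg fun hh => hb (Subtype.ext hh)]
    · simp

/-- Cayley's formula. -/
theorem card_mul_ncard_isTree [Fintype V] [Nonempty V] :
    Fintype.card V * {T : SimpleGraph V | T.IsTree}.ncard =
      Fintype.card V ^ (Fintype.card V - 1) := by
  classical
  obtain ⟨r⟩ := ‹Nonempty V›
  have hk : Fintype.card {v : V // v ≠ r} = Fintype.card V - 1 := Set.card_ne_eq r
  have hV : 0 < Fintype.card V := Fintype.card_pos_iff.2 ⟨r⟩
  have h := (⊤ : SimpleGraph V).det_redIncMatrix_mul_transpose r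
  rw [redIncMatrix_mul_transpose_top] at h
  simp only [le_top, true_and] at h
  -- J has order |V|-1, so J² = (|V|-1)J and the J terms cancel.
  have hmul : ((Fintype.card V : ℤ) • 1 - Matrix.of fun _ _ : {v : V // v ≠ r} => (1 : ℤ)) *
      (1 + Matrix.of fun _ _ => 1) = (Fintype.card V : ℤ) • 1 := by
    have hJ : (Matrix.of fun _ _ : {v : V // v ≠ r} => (1 : ℤ)) * (Matrix.of fun _ _ => 1) =
        ((Fintype.card V : ℤ) - 1) • Matrix.of fun _ _ => 1 := by
      ext i j
      simp only [Matrix.mul_apply, Matrix.of_apply, mul_one, Finset.sum_const, Finset.card_univ,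
        hk, Matrix.smul_apply, nsmul_eq_mul, smul_eq_mul]
      rw [Nat.cast_sub hV, Nat.cast_one]
    rw [sub_mul, mul_add, mul_add, hJ, smul_mul_assoc, one_mul, smul_mul_assoc, one_mul, mul_one,
      sub_smul, one_smul]
    abel
  have hd := congrArg Matrix.det hmul
  rw [Matrix.det_mul, h, Matrix.det_one_add_of_one, Matrix.det_smul, Matrix.det_one, hk, mul_one,
    Nat.cast_sub hV, Nat.cast_one, add_sub_cancel, mul_comm] at hd
  exact_mod_cast hd

end SimpleGraph

/-! ### Binomial estimates -/

theorem Nat.div_pow_mul_choose_le {N m k : ℕ} (hk : 1 ≤ k) (hkm : k ≤ m) (hm : m ≤ N) :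
    ((m : ℝ) / N) ^ k * N.choose k ≤
      Real.exp (k * (k - 1) / (m + 1 - k)) * m.choose k := by
  have hm0 : (0 : ℝ) < m := by exact_mod_cast (by omega : 0 < m)
  have hN0 : (0 : ℝ) < N := by exact_mod_cast (by omega : 0 < N)
  have hf : (0 : ℝ) < k.factorial := by exact_mod_cast k.factorial_pos
  have hd : (0 : ℝ) < m + 1 - k := by
    have : (k : ℝ) ≤ m := by exact_mod_cast hkm
    linarith
  have h1 : (N.choose k : ℝ) ≤ (N : ℝ) ^ k / k.factorial := Nat.choose_le_pow_div k N
  have h2 : ((m : ℝ) + 1 - k) ^ k / k.factorial ≤ m.choose k := by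
    rw [div_le_iff₀ hf, mul_comm]
    have := Nat.pow_sub_le_descFactorial m k
    rw [Nat.descFactorial_eq_factorial_mul_choose] at this
    have h3 : (((m + 1 - k : ℕ) : ℝ)) ^ k ≤ k.factorial * m.choose k := by exact_mod_cast this
    rwa [Nat.cast_sub (by omega), Nat.cast_add, Nat.cast_one] at h3
  -- Here m/(m+1-k) = 1 + (k-1)/(m+1-k), and 1 + x ≤ exp x.
  have h3 : (m : ℝ) ^ k ≤ Real.exp (k * (k - 1) / (m + 1 - k)) * ((m : ℝ) + 1 - k) ^ k := by
    rw [mul_div_assoc, Real.exp_nat_mul, ← mul_pow]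
    refine pow_le_pow_left₀ hm0.le ?_ k
    have := Real.add_one_le_exp (((k : ℝ) - 1) / (m + 1 - k))
    calc (m : ℝ) = (((k : ℝ) - 1) / (m + 1 - k) + 1) * (m + 1 - k) := by field_simp; ring
      _ ≤ _ := mul_le_mul_of_nonneg_right this hd.le
  calc ((m : ℝ) / N) ^ k * N.choose k ≤ ((m : ℝ) / N) ^ k * ((N : ℝ) ^ k / k.factorial) := by
        gcongr
    _ = (m : ℝ) ^ k / k.factorial := by
        rw [div_pow]
        field_simp
    _ ≤ Real.exp (k * (k - 1) / (m + 1 - k)) * ((m : ℝ) + 1 - k) ^ k / k.factorial := by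
        gcongr
    _ = Real.exp (k * (k - 1) / (m + 1 - k)) * (((m : ℝ) + 1 - k) ^ k / k.factorial) := by ring
    _ ≤ _ := by gcongr

/-- If 2k ≤ m, the denominator is at least m/2 ≥ δn²/2. Otherwise δn² ≤ m ≤ 2k forces δn ≤ 2, and a
denominator of at least 1 suffices. -/
theorem mul_sub_one_div_le {δ n m k : ℝ} (hδ : 0 < δ) (hn : k + 1 ≤ n) (hk : 1 ≤ k)
    (hkm : k ≤ m) (hm : δ * n ^ 2 ≤ m) :
    k * (k - 1) / (m + 1 - k) ≤ 4 / δ ^ 2 + 2 / δ := by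
  have hn0 : 0 < n := by linarith
  have hd : 0 < m + 1 - k := by linarith
  rcases le_total (2 * k) m with h | h
  · have : k * (k - 1) / (m + 1 - k) ≤ 2 / δ := by
      rw [div_le_div_iff₀ hd hδ]
      have : k * (k - 1) ≤ n ^ 2 := by nlinarith
      nlinarith
    have : 0 < 4 / δ ^ 2 := by positivity
    linarith
  · have hδn : δ * n ≤ 2 := by
      by_contra! hc
      nlinarith
    have : k * (k - 1) / (m + 1 - k) ≤ 4 / δ ^ 2 := by
      rw [div_le_div_iff₀ hd (by positivity)]
      have h1 : k * (k - 1) ≤ n ^ 2 := by nlinarith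
      have h2 : (δ * n) ^ 2 ≤ 2 ^ 2 := pow_le_pow_left₀ (by positivity) hδn 2
      have h3 : k * (k - 1) * δ ^ 2 ≤ n ^ 2 * δ ^ 2 := by gcongr
      nlinarith
    have : 0 < 2 / δ := by positivity
    linarith

/-! ### Counting graphs with m edges -/

namespace SimpleGraph

theorem ncard_setOf_ncard_edgeSet_le {V : Type*} [Fintype V] (m : ℕ) :
    {G : SimpleGraph V | G.edgeSet.ncard = m}.ncard ≤
      ((Fintype.card V).choose 2).choose m := by
  classical
  rw [← card_edgeFinset_top_eq_card_choose_two, ← Finset.card_powersetCard,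
    ← Set.ncard_coe_finset]
  refine Set.ncard_le_ncard_of_injOn (fun G => G.edgeFinset) ?_ ?_ (Finset.finite_toSet _)
  · intro G hG
    simp only [Finset.mem_coe, Finset.mem_powersetCard]
    refine ⟨edgeFinset_mono le_top, ?_⟩
    rw [← hG, ← coe_edgeFinset, Set.ncard_coe_finset]
  · intro G _ H _ h
    exact edgeFinset_inj.1 h

theorem choose_le_ncard_setOf_le {V : Type*} [Fintype V] (T : SimpleGraph V) {m : ℕ}
    (hm : T.edgeSet.ncard ≤ m) :
    ((Fintype.card V).choose 2 - T.edgeSet.ncard).choose (m - T.edgeSet.ncard) ≤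
      {G : SimpleGraph V | G.edgeSet.ncard = m ∧ T ≤ G}.ncard := by
  classical
  have hT : T.edgeSet.ncard = T.edgeFinset.card := by
    rw [← coe_edgeFinset, Set.ncard_coe_finset]
  have hsub : T.edgeFinset ⊆ (⊤ : SimpleGraph V).edgeFinset := edgeFinset_mono le_top
  have hS : ∀ S ∈ Finset.powersetCard (m - T.edgeFinset.card)
      ((⊤ : SimpleGraph V).edgeFinset \ T.edgeFinset),
      (fromEdgeSet ((S ∪ T.edgeFinset : Finset (Sym2 V)) : Set (Sym2 V))).edgeSet =
        ((S ∪ T.edgeFinset : Finset (Sym2 V)) : Set (Sym2 V)) := by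
    intro S hS
    rw [edgeSet_fromEdgeSet, sdiff_eq_left, Set.disjoint_left]
    intro e he hd
    have : e ∈ (⊤ : SimpleGraph V).edgeFinset := by
      rcases Finset.mem_union.1 he with h | h
      · exact (Finset.mem_sdiff.1 ((Finset.mem_powersetCard.1 hS).1 h)).1
      · exact hsub h
    exact not_isDiag_of_mem_edgeSet _ (mem_edgeFinset.1 this) hd
  rw [hT] at hm ⊢
  rw [← card_edgeFinset_top_eq_card_choose_two, ← Finset.card_sdiff_of_subset hsub,
    ← Finset.card_powersetCard, ← Set.ncard_coe_finset]
  refine Set.ncard_le_ncard_of_injOn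
    (fun S => fromEdgeSet ((S ∪ T.edgeFinset : Finset (Sym2 V)) : Set (Sym2 V))) ?_ ?_
    (Set.toFinite _)
  · intro S h
    rw [Finset.mem_coe] at h
    have hd : Disjoint S T.edgeFinset :=
      Finset.disjoint_of_subset_left (Finset.mem_powersetCard.1 h).1 Finset.sdiff_disjoint
    refine ⟨?_, ?_⟩
    · rw [hS S h, Set.ncard_coe_finset, Finset.card_union_of_disjoint hd,
        (Finset.mem_powersetCard.1 h).2]
      omega
    · rw [← edgeSet_subset_edgeSet, hS S h]
      intro e he
      simp [he]
  · intro S h S' h' hh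
    rw [Finset.mem_coe] at h h'
    have h1 := congrArg edgeSet hh
    simp only at h1
    rw [hS S h, hS S' h', Finset.coe_inj] at h1
    have hd : Disjoint S T.edgeFinset :=
      Finset.disjoint_of_subset_left (Finset.mem_powersetCard.1 h).1 Finset.sdiff_disjoint
    have hd' : Disjoint S' T.edgeFinset :=
      Finset.disjoint_of_subset_left (Finset.mem_powersetCard.1 h').1 Finset.sdiff_disjoint
    rw [← Finset.union_sdiff_cancel_right hd, h1, Finset.union_sdiff_cancel_right hd']

theorem IsTree.ncard_edgeSet {V : Type*} [Fintype V] {T : SimpleGraph V} (hT : T.IsTree) :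
    T.edgeSet.ncard = Fintype.card V - 1 := by
  have := (isTree_iff_connected_and_card.1 hT).2
  rw [Nat.card_coe_set_eq, Nat.card_eq_fintype_card] at this
  omega

end SimpleGraph

/-! ### Lower bound for the expectation -/

theorem integral_uniformOn {Ω : Type*} [Finite Ω] [MeasurableSpace Ω] [MeasurableSingletonClass Ω]
    (s : Finset Ω) (f : Ω → ℝ) :
    ∫ x, f x ∂(uniformOn (s : Set Ω)) = (∑ x ∈ s, f x) / s.card := by
  classical
  rw [uniformOn, ProbabilityTheory.cond, integral_smul_measure, Measure.count_apply_finset,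
    setIntegral_finset _ Integrable.of_finite.integrableOn]
  simp [div_eq_inv_mul]

theorem ncard_mul_choose_le_sum_numSpanningTrees {n m : ℕ} (hn : n - 1 ≤ m)
    [Fintype {G : SimpleGraph (Fin n) | G.edgeSet.ncard = m}] :
    {T : SimpleGraph (Fin n) | T.IsTree}.ncard * (n.choose 2 - (n - 1)).choose (m - (n - 1)) ≤
      ∑ G ∈ {G : SimpleGraph (Fin n) | G.edgeSet.ncard = m}.toFinset, numSpanningTrees G := by
  classical
  have h1 : ∀ G : SimpleGraph (Fin n), numSpanningTrees G =
      ∑ T ∈ {T : SimpleGraph (Fin n) | T.IsTree}.toFinset, if T ≤ G then 1 else 0 := by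
    intro G
    rw [numSpanningTrees, Set.ncard_eq_toFinset_card', Finset.sum_boole]
    simp only [Nat.cast_id]
    congr 1
    ext T
    simp [and_comm]
  rw [Finset.sum_congr rfl fun G _ => h1 G, Finset.sum_comm, Set.ncard_eq_toFinset_card',
    ← smul_eq_mul]
  refine Finset.card_nsmul_le_sum _ _ _ fun T hT => ?_
  rw [Set.mem_toFinset] at hT
  have h2 := SimpleGraph.IsTree.ncard_edgeSet hT
  rw [Fintype.card_fin] at h2
  have h3 := T.choose_le_ncard_setOf_le (m := m) (h2 ▸ hn)
  rw [h2, Fintype.card_fin] at h3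
  refine h3.trans (le_of_eq ?_)
  rw [Set.ncard_eq_toFinset_card', Finset.sum_boole]
  simp only [Nat.cast_id]
  congr 1
  ext G
  simp

instance SimpleGraph.instMeasurableSingletonClass {V : Type*} [Finite V] :
    MeasurableSingletonClass (SimpleGraph V) :=
  ⟨fun G => ⟨{G.Adj}, measurableSet_singleton _, by
    ext H
    exact SimpleGraph.adj_inj⟩⟩

/-- A lower bound for the expected number of spanning trees of the random graph `G(n,m)`. -/
theorem le_integral_numSpanningTrees {n m : ℕ} (hn : 2 ≤ n) (hnm : n - 1 ≤ m)
    (hm : m ≤ n.choose 2) :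
    ({T : SimpleGraph (Fin n) | T.IsTree}.ncard : ℝ) * m.choose (n - 1) ≤
      (n.choose 2).choose (n - 1) * ∫ H, (numSpanningTrees H : ℝ) ∂(gnm n m) := by
  classical
  set S := {G : SimpleGraph (Fin n) | G.edgeSet.ncard = m} with hS
  have hint : ∫ H, (numSpanningTrees H : ℝ) ∂(gnm n m) =
      ((∑ G ∈ S.toFinset, numSpanningTrees G : ℕ) : ℝ) / S.ncard := by
    have h := integral_uniformOn S.toFinset fun H => (numSpanningTrees H : ℝ)
    rwa [Set.coe_toFinset, ← Set.ncard_eq_toFinset_card', ← Nat.cast_sum] at h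
  have h1 : ({T : SimpleGraph (Fin n) | T.IsTree}.ncard : ℝ) *
      (n.choose 2 - (n - 1)).choose (m - (n - 1)) ≤
      ((∑ G ∈ S.toFinset, numSpanningTrees G : ℕ) : ℝ) := by
    exact_mod_cast ncard_mul_choose_le_sum_numSpanningTrees hnm
  have h2 : (S.ncard : ℝ) ≤ (n.choose 2).choose m := by
    have := SimpleGraph.ncard_setOf_ncard_edgeSet_le (V := Fin n) m
    rw [Fintype.card_fin] at this
    exact_mod_cast this
  have h3 : ((n.choose 2).choose m : ℝ) * m.choose (n - 1) =
      (n.choose 2).choose (n - 1) * (n.choose 2 - (n - 1)).choose (m - (n - 1)) := by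
    exact_mod_cast Nat.choose_mul hnm
  -- If S were empty the double count would vanish, while its lower bound is positive.
  have hS0 : 0 < S.ncard := by
    rcases Nat.eq_zero_or_pos S.ncard with h | h
    · have h4 : S.toFinset = ∅ := by
        rw [← Finset.card_eq_zero, ← Set.ncard_eq_toFinset_card', h]
      have hpos : 0 < (n.choose 2 - (n - 1)).choose (m - (n - 1)) := Nat.choose_pos (by omega)
      have hT : 0 < {T : SimpleGraph (Fin n) | T.IsTree}.ncard := by
        have : Nonempty (Fin n) := ⟨⟨0, by omega⟩⟩
        have := SimpleGraph.card_mul_ncard_isTree (V := Fin n)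
        rw [Fintype.card_fin] at this
        exact Nat.pos_of_mul_pos_left (this ▸ pow_pos (by omega) _)
      have h5 := ncard_mul_choose_le_sum_numSpanningTrees hnm
      rw [h4, Finset.sum_empty] at h5
      have := Nat.mul_pos hT hpos
      omega
    · exact h
  have hS0' : (0 : ℝ) < S.ncard := by exact_mod_cast hS0
  have hc : (0 : ℝ) < (n.choose 2).choose m := by exact_mod_cast Nat.choose_pos hm
  rw [hint, mul_div_assoc', le_div_iff₀ hS0']
  calc _ ≤ ({T : SimpleGraph (Fin n) | T.IsTree}.ncard : ℝ) * m.choose (n - 1) *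
        (n.choose 2).choose m := by gcongr
    _ = (n.choose 2).choose (n - 1) * ({T : SimpleGraph (Fin n) | T.IsTree}.ncard *
        (n.choose 2 - (n - 1)).choose (m - (n - 1))) := by
      rw [mul_assoc, mul_comm (m.choose (n - 1) : ℝ), h3]
      ring
    _ ≤ _ := by gcongr

/-! ### Comparison with the mean, and conclusion -/

/-- The number of spanning trees of a dense graph is always bounded by a constant multiple of the
average number over all graphs of the same size. -/
theorem numSpanningTrees_le_mul_integral {δ : ℝ} (hδ : 0 < δ) {n m : ℕ} (hn : 2 ≤ n)
    (hδm : δ * (n : ℝ) ^ 2 ≤ m) (hm : m ≤ n.choose 2) (G : SimpleGraph (Fin n))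
    (hG : G.edgeSet.ncard = m) :
    (numSpanningTrees G : ℝ) ≤
      Real.exp (4 / δ ^ 2 + 2 / δ) * ∫ H, (numSpanningTrees H : ℝ) ∂(gnm n m) := by
  classical
  have hI : 0 ≤ ∫ H, (numSpanningTrees H : ℝ) ∂(gnm n m) :=
    integral_nonneg fun _ => Nat.cast_nonneg _
  rcases lt_or_ge m (n - 1) with hnm | hnm
  · have h0 : numSpanningTrees G = 0 := by
      rw [numSpanningTrees, Set.ncard_eq_zero (Set.toFinite _), Set.eq_empty_iff_forall_notMem]
      rintro T ⟨hTG, hT⟩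
      have h1 := hT.ncard_edgeSet
      have h2 := Set.ncard_le_ncard (SimpleGraph.edgeSet_mono hTG) (Set.toFinite _)
      rw [Fintype.card_fin] at h1
      omega
    rw [h0, Nat.cast_zero]
    positivity
  have : Nonempty (Fin n) := ⟨⟨0, by omega⟩⟩
  obtain ⟨k, rfl⟩ : ∃ k, n = k + 1 := ⟨n - 1, by omega⟩
  have hcay := SimpleGraph.card_mul_ncard_isTree (V := Fin (k + 1))
  have hup := SimpleGraph.card_mul_ncard_isTree_le G
  have hE := le_integral_numSpanningTrees hn hnm hm
  rw [Fintype.card_fin, Nat.add_sub_cancel] at hup hcay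
  rw [Nat.add_sub_cancel] at hE hnm
  rw [hG] at hup
  have hk : 1 ≤ k := by omega
  have hk0 : (0 : ℝ) < k := by exact_mod_cast hk
  have hN : (((k + 1).choose 2 : ℕ) : ℝ) = (k + 1) * k / 2 := by
    rw [Nat.cast_choose_two]
    push_cast
    ring
  set I := ∫ H, (numSpanningTrees H : ℝ) ∂(gnm (k + 1) m)
  set τ : ℝ := ({T : SimpleGraph (Fin (k + 1)) | T.IsTree}.ncard : ℝ) with hτ
  have hcay' : ((k : ℝ) + 1) * τ = (k + 1) ^ k := by
    rw [hτ]
    exact_mod_cast hcay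
  -- With n = k+1, 2m/k = n·m/N, and Cayley's formula turns the factor n^k into nτ.
  have hX : (numSpanningTrees G : ℝ) ≤ τ * ((m : ℝ) / (k + 1).choose 2) ^ k := by
    have h1 : ((k : ℝ) + 1) * numSpanningTrees G ≤
        (k + 1) * (τ * ((m : ℝ) / (k + 1).choose 2) ^ k) := by
      rw [← mul_assoc, hcay', ← mul_pow, hN, numSpanningTrees]
      push_cast at hup
      refine hup.trans (le_of_eq ?_)
      congr 1
      field_simp
    exact le_of_mul_le_mul_left h1 (by positivity)
  have hCpos : (0 : ℝ) < ((k + 1).choose 2).choose k := by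
    exact_mod_cast Nat.choose_pos (hnm.trans hm)
  have hexp : Real.exp (k * (k - 1) / (m + 1 - k)) ≤ Real.exp (4 / δ ^ 2 + 2 / δ) :=
    Real.exp_le_exp.2 (mul_sub_one_div_le (n := ((k + 1 : ℕ) : ℝ)) hδ (by push_cast; rfl)
      (by exact_mod_cast hk) (by exact_mod_cast hnm) hδm)
  have hτ0 : 0 ≤ τ := Nat.cast_nonneg _
  refine le_of_mul_le_mul_right ?_ hCpos
  calc (numSpanningTrees G : ℝ) * ((k + 1).choose 2).choose k
      ≤ τ * ((m : ℝ) / (k + 1).choose 2) ^ k * ((k + 1).choose 2).choose k := by gcongr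
    _ = τ * (((m : ℝ) / (k + 1).choose 2) ^ k * ((k + 1).choose 2).choose k) := by ring
    _ ≤ τ * (Real.exp (k * (k - 1) / (m + 1 - k)) * m.choose k) := by
      exact mul_le_mul_of_nonneg_left (Nat.div_pow_mul_choose_le hk hnm hm) hτ0
    _ ≤ τ * (Real.exp (4 / δ ^ 2 + 2 / δ) * m.choose k) := by gcongr
    _ = Real.exp (4 / δ ^ 2 + 2 / δ) * (τ * m.choose k) := by ring
    _ ≤ Real.exp (4 / δ ^ 2 + 2 / δ) * (((k + 1).choose 2).choose k * I) := by gcongr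
    _ = _ := by ring

theorem mainTheorem3 (δ : ℝ) (hδ0 : 0 < δ) (hδ : δ < 1 / 2) (t : ℕ) :
    ∃ K : ℝ, ∀ n m : ℕ, 1 ≤ n →
      δ * (n : ℝ) ^ 2 ≤ (m : ℝ) → (m : ℝ) ≤ (1 - δ) * (n : ℝ) ^ 2 → m ≤ n.choose 2 →
      (gnm n m).real {G : SimpleGraph (Fin n) |
          (numSpanningTrees G : ℝ) > K * ∫ H, (numSpanningTrees H : ℝ) ∂(gnm n m)}
        ≤ 1 / (n : ℝ) ^ t := by
  refine ⟨Real.exp (4 / δ ^ 2 + 2 / δ), fun n m hn hδm _ hm => ?_⟩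
  -- For n = 1 there are no edges, which contradicts δ ≤ m.
  have hn2 : 2 ≤ n := by
    rcases hn.eq_or_lt with rfl | h
    · have h0 : m = 0 := by simpa using hm
      rw [h0, Nat.cast_one, Nat.cast_zero] at hδm
      linarith
    · exact h
  have h0 : gnm n m {G : SimpleGraph (Fin n) |
      (numSpanningTrees G : ℝ) > Real.exp (4 / δ ^ 2 + 2 / δ) *
        ∫ H, (numSpanningTrees H : ℝ) ∂(gnm n m)} = 0 := by
    conv_lhs => rw [gnm]
    rw [uniformOn_eq_zero_iff (Set.toFinite _), Set.eq_empty_iff_forall_notMem]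
    rintro G ⟨hG, hlt⟩
    exact absurd hlt (not_lt.2 (numSpanningTrees_le_mul_integral hδ0 hn2 hδm hm G hG))
  rw [measureReal_def, h0, ENNReal.toReal_zero]
  positivity
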